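/- Let $K$ be a field. For $q\in K^*=K\setminus\{0\}$ let $\mathcal{H}_q$, the quantum Heisenberg algebra, be the unital associative $K$-algebra generated by $t,x,y$ with defining relations $$yx-qxy=t,\qquad xt=q\,tx,\qquad yt=q^{-1}ty;$$ it is the case $p=q$ of the Gaddis two-parameter quantum Heisenberg algebra $G\mathcal{H}_{p,q}$, $p,q\in K^*$, which is generated by $t,x,y$ with defining relations $yx-qxy=t$, $xt=p\,tx$, $yt=p^{-1}ty$. For a polynomial $f\in K[t]$ let $\mathcal{H}(f)$, the generalized Heisenberg algebra, be the unital associative $K$-algebra generated by $t,x,y$ with defining relations $$tx=xf(t),\qquad yt=f(t)y,\qquad yx-xy=f(t)-t.$$ Then, up to isomorphism, the classes of generalized Heisenberg algebras and quantum Heisenberg algebras over $K$ are disjoint: for every $q\in K^*$ and every $f\in K[t]$, the $K$-algebras $\mathcal{H}_q$ and $\mathcal{H}(f)$ are not isomorphic. -/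

import Mathlib

open Polynomial

namespace HeisenbergAlgebras

/-- Names of the three generators `t`, `x`, `y`. -/
inductive Gen : Type
  | t
  | x
  | y

variable (K : Type*) [Field K]

/-- The free generator `t` of `K⟨t, x, y⟩`. -/
abbrev freeT : FreeAlgebra K Gen := FreeAlgebra.ι K Gen.t

/-- The free generator `x` of `K⟨t, x, y⟩`. -/
abbrev freeX : FreeAlgebra K Gen := FreeAlgebra.ι K Gen.x

/-- The free generator `y` of `K⟨t, x, y⟩`. -/
abbrev freeY : FreeAlgebra K Gen := FreeAlgebra.ι K Gen.y

variable {K}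

/-- The defining relations `yx - qxy = t`, `xt = ptx`, `yt = p⁻¹ty`. -/
inductive GaddisRel (p q : Kˣ) : FreeAlgebra K Gen → FreeAlgebra K Gen → Prop
  | yx : GaddisRel p q (freeY K * freeX K - (q : K) • (freeX K * freeY K)) (freeT K)
  | xt : GaddisRel p q (freeX K * freeT K) ((p : K) • (freeT K * freeX K))
  | yt : GaddisRel p q (freeY K * freeT K) ((p : K)⁻¹ • (freeT K * freeY K))

/-- The Gaddis two-parameter quantum Heisenberg algebra `GH_{p,q}`: the unital associative
`K`-algebra generated by `t`, `x`, `y` subject to `GaddisRel`. -/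
abbrev GaddisHeisenberg (p q : Kˣ) : Type _ := RingQuot (GaddisRel p q)

/-- The quantum Heisenberg algebra `H_q = GH_{q,q}`, with defining relations
`yx - qxy = t`, `xt = qtx`, `yt = q⁻¹ty`. -/
abbrev QuantumHeisenberg (q : Kˣ) : Type _ := GaddisHeisenberg q q

/-- The defining relations `tx = x f(t)`, `yt = f(t) y`, `yx - xy = f(t) - t`. -/
inductive GenHeisenbergRel (f : K[X]) : FreeAlgebra K Gen → FreeAlgebra K Gen → Prop
  | tx : GenHeisenbergRel f (freeT K * freeX K) (freeX K * aeval (freeT K) f)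
  | yt : GenHeisenbergRel f (freeY K * freeT K) (aeval (freeT K) f * freeY K)
  | yx : GenHeisenbergRel f (freeY K * freeX K - freeX K * freeY K)
      (aeval (freeT K) f - freeT K)

/-- The generalized Heisenberg algebra `H(f)`: the unital associative `K`-algebra generated by
`t`, `x`, `y` subject to `GenHeisenbergRel`. -/
abbrev GeneralizedHeisenberg (f : K[X]) : Type _ := RingQuot (GenHeisenbergRel f)

end HeisenbergAlgebras

/-! The invariants are tangent vectors at a character, i.e. lifts of it to `TrivSqZeroExt K M`. A
character of `H(f)` sends `t` to a fixed point `c` of `f`; the tangent coordinates of `x` and `y`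
are then free, and that of `t` is free too when `f'(c) = 1`. If `q ≠ 1`, the character `x ↦ 1` of
`H_q` has tangent dimension at most 1, whereas `H(f)` always gives at least 2 (`isEmpty_of_ne_one`).
If `q = 1`, lifts of characters kill `t = yx - xy`, so tangent dimensions are at most 2. Hence
`f'(c) ≠ 1`; but then `H(f)` has a noncommutative upper triangular 2 × 2 representation, which `H_1`
lacks (`isEmpty_of_eq_one`). -/

namespace HeisenbergAlgebras

variable {K : Type*} [Field K]

/-! ### Presented algebras and their homomorphisms -/

/-- A homomorphism from a presented algebra takes values in any subalgebra containing the images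
of the generators. -/
theorem map_mem_of_generators {B : Type*} [Ring B] [Algebra K B]
    {r : FreeAlgebra K Gen → FreeAlgebra K Gen → Prop} (φ : RingQuot r →ₐ[K] B)
    (S : Subalgebra K B) (h : ∀ g, φ (RingQuot.mkAlgHom K r (FreeAlgebra.ι K g)) ∈ S)
    (a : RingQuot r) : φ a ∈ S := by
  obtain ⟨a, rfl⟩ := RingQuot.mkAlgHom_surjective K r a
  induction a using FreeAlgebra.induction with
  | grade0 k => rw [AlgHom.commutes, AlgHom.commutes]; exact S.algebraMap_mem k
  | grade1 g => exact h g
  | mul a b ha hb => rw [map_mul, map_mul]; exact S.mul_mem ha hb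
  | add a b ha hb => rw [map_add, map_add]; exact S.add_mem ha hb

/-- First order Taylor expansion of a polynomial at a scalar, in a square-zero direction. -/
theorem aeval_algebraMap_add_of_mul_self_eq_zero {B : Type*} [Ring B] [Algebra K B] (f : K[X])
    (c : K) (n : B) (hn : n * n = 0) :
    aeval (algebraMap K B c + n) f = algebraMap K B (f.eval c) + f.derivative.eval c • n := by
  have expand : ∀ p : K[X], ∃ g, p = C (p.eval c) + (X - C c) * g := fun p => by
    obtain ⟨g, hg⟩ := X_sub_C_dvd_sub_C_eval (a := c) (p := p)
    exact ⟨g, by rw [← hg]; ring⟩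
  obtain ⟨g, hg⟩ := expand f
  obtain ⟨h, hh⟩ := expand g
  have hd : f.derivative.eval c = g.eval c := by rw [hg]; simp
  have hgn : n * aeval (algebraMap K B c + n) g = g.eval c • n := by
    rw [hh]
    simp [mul_add, ← mul_assoc, hn, Algebra.smul_def, Algebra.commutes]
  rw [hd, ← hgn]
  conv_lhs => rw [hg]
  simp

/-- The universal property of `GH_{p,q}`. -/
theorem exists_gaddisHom {B : Type*} [Ring B] [Algebra K B] (p q : Kˣ) (t x y : B)
    (h₁ : y * x - (q : K) • (x * y) = t) (h₂ : x * t = (p : K) • (t * x))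
    (h₃ : y * t = (p : K)⁻¹ • (t * y)) :
    ∃ φ : GaddisHeisenberg p q →ₐ[K] B,
      φ (RingQuot.mkAlgHom K _ (freeT K)) = t ∧ φ (RingQuot.mkAlgHom K _ (freeX K)) = x ∧
        φ (RingQuot.mkAlgHom K _ (freeY K)) = y := by
  refine ⟨RingQuot.liftAlgHom K ⟨FreeAlgebra.lift K (fun g => Gen.rec t x y g), ?_⟩, ?_⟩
  · rintro _ _ (_ | _ | _) <;> simp [h₁, h₂, h₃]
  · simp

/-- The universal property of `H(f)`. -/
theorem exists_genHom {B : Type*} [Ring B] [Algebra K B] (f : K[X]) (t x y : B)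
    (h₁ : t * x = x * aeval t f) (h₂ : y * t = aeval t f * y)
    (h₃ : y * x - x * y = aeval t f - t) :
    ∃ φ : GeneralizedHeisenberg f →ₐ[K] B,
      φ (RingQuot.mkAlgHom K _ (freeT K)) = t ∧ φ (RingQuot.mkAlgHom K _ (freeX K)) = x ∧
        φ (RingQuot.mkAlgHom K _ (freeY K)) = y := by
  refine ⟨RingQuot.liftAlgHom K ⟨FreeAlgebra.lift K (fun g => Gen.rec t x y g), ?_⟩, ?_⟩
  · rintro _ _ (_ | _ | _) <;> simp [h₁, h₂, h₃, ← aeval_algHom_apply]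
  · simp

/-- The relations of `GH_{p,q}` hold for the images of the generators. -/
theorem gaddis_relations {B : Type*} [Ring B] [Algebra K B] {p q : Kˣ}
    (φ : GaddisHeisenberg p q →ₐ[K] B) {t x y : B}
    (ht : φ (RingQuot.mkAlgHom K _ (freeT K)) = t) (hx : φ (RingQuot.mkAlgHom K _ (freeX K)) = x)
    (hy : φ (RingQuot.mkAlgHom K _ (freeY K)) = y) :
    y * x - (q : K) • (x * y) = t ∧ x * t = (p : K) • (t * x) ∧
      y * t = (p : K)⁻¹ • (t * y) := by
  subst ht hx hy
  refine ⟨?_, ?_, ?_⟩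
  · simpa using congrArg φ (RingQuot.mkAlgHom_rel K (GaddisRel.yx (p := p) (q := q)))
  · simpa using congrArg φ (RingQuot.mkAlgHom_rel K (GaddisRel.xt (p := p) (q := q)))
  · simpa using congrArg φ (RingQuot.mkAlgHom_rel K (GaddisRel.yt (p := p) (q := q)))

/-- Under a character of `H(f)`, the generator `t` goes to a fixed point of `f`. -/
theorem eval_eq_of_character {f : K[X]} (χ : GeneralizedHeisenberg f →ₐ[K] K) :
    f.eval (χ (RingQuot.mkAlgHom K _ (freeT K))) = χ (RingQuot.mkAlgHom K _ (freeT K)) := by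
  have h := congrArg χ (RingQuot.mkAlgHom_rel K (GenHeisenbergRel.yx (f := f)))
  simp only [map_sub, map_mul, ← aeval_algHom_apply] at h
  rw [mul_comm, sub_self, coe_aeval_eq_eval] at h
  exact (sub_eq_zero.mp h.symm)

/-- If the tangent vectors of the three generators lie in a subspace, so do all tangent vectors. -/
theorem snd_mem_of_generators {M : Type*} [AddCommGroup M] [Module K M] [Module Kᵐᵒᵖ M]
    [IsCentralScalar K M]
    {r : FreeAlgebra K Gen → FreeAlgebra K Gen → Prop} (φ : RingQuot r →ₐ[K] TrivSqZeroExt K M)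
    (W : Submodule K M) (h : ∀ g, (φ (RingQuot.mkAlgHom K r (FreeAlgebra.ι K g))).snd ∈ W)
    (a : RingQuot r) : (φ a).snd ∈ W := by
  let S : Subalgebra K (TrivSqZeroExt K M) :=
    { carrier := {b | b.snd ∈ W}
      mul_mem' := fun {a b} ha hb => by
        simp only [Set.mem_ofPred_eq, TrivSqZeroExt.snd_mul, op_smul_eq_smul] at *
        exact W.add_mem (W.smul_mem _ hb) (W.smul_mem _ ha)
      add_mem' := fun ha hb => W.add_mem ha hb
      algebraMap_mem' := fun k => by simp [TrivSqZeroExt.algebraMap_eq_inl] }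
  exact map_mem_of_generators φ S h a

/-! ### Upper triangular 2 × 2 representations -/

/-- Homomorphisms from `H_1` to upper triangular `2 × 2` matrices have commutative image. -/
theorem commute_of_upperTriangular (φ : QuantumHeisenberg (1 : Kˣ) →ₐ[K] Matrix (Fin 2) (Fin 2) K)
    (hφ : ∀ a, φ a 1 0 = 0) (a b : QuantumHeisenberg (1 : Kˣ)) : φ a * φ b = φ b * φ a := by
  obtain ⟨h₁, h₂, h₃⟩ := gaddis_relations φ rfl rfl rfl
  have hx := hφ (RingQuot.mkAlgHom K _ (freeX K))
  have hy := hφ (RingQuot.mkAlgHom K _ (freeY K))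
  have hg : ∀ g g', φ (RingQuot.mkAlgHom K _ (FreeAlgebra.ι K g)) *
      φ (RingQuot.mkAlgHom K _ (FreeAlgebra.ι K g')) =
      φ (RingQuot.mkAlgHom K _ (FreeAlgebra.ι K g')) *
      φ (RingQuot.mkAlgHom K _ (FreeAlgebra.ι K g)) := by
    have ht : φ (RingQuot.mkAlgHom K _ (freeT K)) = 0 := by
      generalize φ (RingQuot.mkAlgHom K _ (freeT K)) = T at *
      generalize φ (RingQuot.mkAlgHom K _ (freeX K)) = X at *
      generalize φ (RingQuot.mkAlgHom K _ (freeY K)) = Y at *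
      simp only [Units.val_one, one_smul, inv_one] at h₁ h₂ h₃
      have e₁ := congrFun (congrFun h₁ 0) 1
      have e₂ := congrFun (congrFun h₂ 0) 1
      have e₃ := congrFun (congrFun h₃ 0) 1
      have t₀ := congrFun (congrFun h₁ 0) 0
      have t₁ := congrFun (congrFun h₁ 1) 1
      have t₂ := congrFun (congrFun h₁ 1) 0
      simp only [Matrix.sub_apply, Matrix.mul_apply, Fin.sum_univ_two, hx, hy] at e₁ e₂ e₃ t₀ t₁ t₂
      have t₀' : T 0 0 = 0 := by rw [← t₀]; ring
      have t₁' : T 1 1 = 0 := by rw [← t₁]; ring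
      have t₂' : T 1 0 = 0 := by rw [← t₂]; ring
      rw [t₀', t₁'] at e₂ e₃
      -- Centrality of `T` gives `(X₀₀ - X₁₁) T₀₁ = (Y₀₀ - Y₁₁) T₀₁ = 0`, while `T₀₁` is a
      -- combination of these two diagonal differences.
      have : T 0 1 * T 0 1 = 0 := by
        linear_combination (-T 0 1) * e₁ - Y 0 1 * e₂ + X 0 1 * e₃
      have t₃ : T 0 1 = 0 := mul_self_eq_zero.mp this
      ext i j
      fin_cases i <;> fin_cases j <;> simp [t₀', t₁', t₂', t₃]
    rw [ht] at h₁
    have hc := sub_eq_zero.mp h₁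
    rw [Units.val_one, one_smul] at hc
    rintro (_ | _ | _) (_ | _ | _) <;> simp [ht, hc]
  -- Commutation spreads from generators to all elements one argument at a time, since centralizers
  -- are subalgebras.
  have key : ∀ g a, φ a * φ (RingQuot.mkAlgHom K _ (FreeAlgebra.ι K g)) =
      φ (RingQuot.mkAlgHom K _ (FreeAlgebra.ι K g)) * φ a := fun g a =>
    (Subalgebra.mem_centralizer_iff K |>.mp (map_mem_of_generators φ
      (Subalgebra.centralizer K {φ (RingQuot.mkAlgHom K _ (FreeAlgebra.ι K g))})
      (fun g' => Subalgebra.mem_centralizer_iff K |>.mpr (by rintro _ rfl; exact hg _ _)) a)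
      _ rfl).symm
  exact (Subalgebra.mem_centralizer_iff K |>.mp (map_mem_of_generators φ
      (Subalgebra.centralizer K {φ a})
      (fun g' => Subalgebra.mem_centralizer_iff K |>.mpr (by rintro _ rfl; exact key _ _)) b)
      _ rfl)

/-- A fixed point `c` of `f` with `f'(c) ≠ 1` gives a noncommutative upper triangular
representation of `H(f)`. -/
theorem exists_upperTriangular_not_commute (f : K[X]) (c : K) (hc : f.eval c = c)
    (hd : f.derivative.eval c ≠ 1) :
    ∃ φ : GeneralizedHeisenberg f →ₐ[K] Matrix (Fin 2) (Fin 2) K,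
      (∀ a, φ a 1 0 = 0) ∧ ∃ a b, φ a * φ b ≠ φ b * φ a := by
  have hf := aeval_algebraMap_add_of_mul_self_eq_zero f c (!![0, 1; 0, 0] : Matrix _ _ K)
    (by ext i j; fin_cases i <;> fin_cases j <;> simp [Matrix.mul_apply])
  -- With `E = !![0, 1; 0, 0]`, `f(c + E) = c + f'(c) E`, while `yx = f'(c) E` and `xy = E`.
  obtain ⟨φ, ht, hx, hy⟩ := exists_genHom f
    (algebraMap K (Matrix (Fin 2) (Fin 2) K) c + !![0, 1; 0, 0])
    !![1, 0; 0, f.derivative.eval c] !![0, 1; 0, 0]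
    (by rw [hf]; ext i j
        fin_cases i <;> fin_cases j <;> simp [Matrix.mul_apply, Matrix.algebraMap_matrix_apply, hc,
          mul_comm])
    (by rw [hf]; ext i j
        fin_cases i <;> fin_cases j <;> simp [Matrix.mul_apply, Matrix.algebraMap_matrix_apply, hc])
    (by rw [hf]; ext i j
        fin_cases i <;> fin_cases j <;> simp [Matrix.algebraMap_matrix_apply, hc])
  let S : Subalgebra K (Matrix (Fin 2) (Fin 2) K) :=
    { carrier := {b | b 1 0 = 0}
      mul_mem' := fun {a b} ha hb => by
        simp only [Set.mem_ofPred_eq, Matrix.mul_apply, Fin.sum_univ_two] at *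
        simp [ha, hb]
      add_mem' := fun {a b} ha hb => by
        simp only [Set.mem_ofPred_eq, Matrix.add_apply] at *
        simp [ha, hb]
      algebraMap_mem' := fun k => by simp [Matrix.algebraMap_matrix_apply] }
  refine ⟨φ, map_mem_of_generators φ S ?_, RingQuot.mkAlgHom K _ (freeX K),
    RingQuot.mkAlgHom K _ (freeY K), fun h => hd ?_⟩
  · rintro (_ | _ | _)
    · rw [ht]; change _ = _; simp [Matrix.algebraMap_matrix_apply]
    · rw [hx]; rfl
    · rw [hy]; rfl
  · rw [hx, hy] at h
    simpa [Matrix.mul_apply] using (congrFun (congrFun h 0) 1).symm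

/-! ### Tangent vectors at characters -/

section Tangent

open TrivSqZeroExt

variable {M : Type*} [AddCommGroup M] [Module K M] [Module Kᵐᵒᵖ M] [IsCentralScalar K M]

/-- Tangent vectors of `H(f)` at a character `χ`. -/
theorem exists_genHom_trivSqZeroExt {f : K[X]} (χ : GeneralizedHeisenberg f →ₐ[K] K) (w u v : M)
    (hw : f.derivative.eval (χ (RingQuot.mkAlgHom K _ (freeT K))) • w = w) :
    ∃ ψ : GeneralizedHeisenberg f →ₐ[K] TrivSqZeroExt K M,
      (∀ a, (ψ a).fst = χ a) ∧ (ψ (RingQuot.mkAlgHom K _ (freeT K))).snd = w ∧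
        (ψ (RingQuot.mkAlgHom K _ (freeX K))).snd = u ∧
        (ψ (RingQuot.mkAlgHom K _ (freeY K))).snd = v := by
  have hc := eval_eq_of_character χ
  set c := χ (RingQuot.mkAlgHom K _ (freeT K))
  have hf := aeval_algebraMap_add_of_mul_self_eq_zero f c (inr w : TrivSqZeroExt K M)
    (inr_mul_inr K w w)
  rw [hc, ← inr_smul, hw] at hf
  obtain ⟨ψ, ht, hx, hy⟩ := exists_genHom f
    (algebraMap K (TrivSqZeroExt K M) c + inr w)
    (inl (χ (RingQuot.mkAlgHom K _ (freeX K))) + inr u)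
    (inl (χ (RingQuot.mkAlgHom K _ (freeY K))) + inr v)
    -- The target is commutative and `hf` says `f(t) = t` there, so every relation becomes trivial.
    (by rw [hf, mul_comm]) (by rw [hf, mul_comm]) (by rw [hf, mul_comm, sub_self, sub_self])
  refine ⟨ψ, fun a => ?_, by simp [ht, algebraMap_eq_inl], by simp [hx], by simp [hy]⟩
  refine DFunLike.congr_fun (f := (fstHom K K M).comp ψ) (g := χ) ?_ a
  ext g
  rcases g with _ | _ | _
  · simp [ht, algebraMap_eq_inl, c]
  · simp [hx]
  · simp [hy]

/-- A subspace containing the tangent vectors of the generators of `H_q`, transported along an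
isomorphism, contains all tangent vectors of `H(f)`. -/
theorem snd_mem_of_algEquiv {q : Kˣ} {f : K[X]}
    (e : QuantumHeisenberg q ≃ₐ[K] GeneralizedHeisenberg f)
    (ψ : GeneralizedHeisenberg f →ₐ[K] TrivSqZeroExt K M) (W : Submodule K M)
    (hW : ∀ g, (ψ (e (RingQuot.mkAlgHom K _ (FreeAlgebra.ι K g)))).snd ∈ W)
    (a : GeneralizedHeisenberg f) : (ψ a).snd ∈ W := by
  simpa using snd_mem_of_generators (ψ.comp e.toAlgHom) W hW (e.symm a)

end Tangent

/-! ### The cases `q = 1` and `q ≠ 1` -/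

/-- The algebra `H_q` has a character sending `x` to `1`. -/
theorem exists_character (q : Kˣ) : ∃ χ : QuantumHeisenberg q →ₐ[K] K,
    χ (RingQuot.mkAlgHom K _ (freeX K)) = 1 := by
  obtain ⟨χ, -, hχ, -⟩ := exists_gaddisHom q q (0 : K) 1 0 (by simp) (by simp) (by simp)
  exact ⟨χ, hχ⟩

theorem derivative_eval_eq_one {f : K[X]}
    (e : QuantumHeisenberg (1 : Kˣ) ≃ₐ[K] GeneralizedHeisenberg f) {c : K} (hc : f.eval c = c) :
    f.derivative.eval c = 1 := by
  by_contra hd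
  obtain ⟨φ, hφ, a, b, hab⟩ := exists_upperTriangular_not_commute f c hc hd
  refine hab ?_
  simpa using commute_of_upperTriangular (φ.comp e.toAlgHom) (fun a => hφ (e a))
    (e.symm a) (e.symm b)

theorem isEmpty_of_eq_one (f : K[X]) :
    IsEmpty (QuantumHeisenberg (1 : Kˣ) ≃ₐ[K] GeneralizedHeisenberg f) := by
  refine ⟨fun e => ?_⟩
  obtain ⟨χ, -⟩ := exists_character (1 : Kˣ)
  let χ' : GeneralizedHeisenberg f →ₐ[K] K := χ.comp e.symm.toAlgHom
  have hd := derivative_eval_eq_one e (eval_eq_of_character χ')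
  -- The generators of `H(f)` get the standard basis of `K³` as tangent vectors, yet two vectors
  -- coming from `H_1` must span them.
  obtain ⟨ψ, -, ht, hx, hy⟩ := exists_genHom_trivSqZeroExt χ'
    (Pi.single 0 1 : Fin 3 → K) (Pi.single 1 1) (Pi.single 2 1) (by rw [hd, one_smul])
  have hq := (gaddis_relations (ψ.comp e.toAlgHom) rfl rfl rfl).1
  rw [mul_comm, Units.val_one, one_smul, sub_self] at hq
  let s : Fin 2 → Fin 3 → K := ![(ψ (e (RingQuot.mkAlgHom K _ (freeX K)))).snd,
    (ψ (e (RingQuot.mkAlgHom K _ (freeY K)))).snd]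
  have hW := snd_mem_of_algEquiv e ψ (Submodule.span K (Set.range s)) (by
    rintro (_ | _ | _)
    · have : ψ (e (RingQuot.mkAlgHom K _ (freeT K))) = 0 := hq.symm
      rw [this]; exact Submodule.zero_mem _
    · exact Submodule.subset_span ⟨0, rfl⟩
    · exact Submodule.subset_span ⟨1, rfl⟩)
  have htop : Submodule.span K (Set.range s) = ⊤ := by
    rw [eq_top_iff, ← (Pi.basisFun K (Fin 3)).span_eq, Submodule.span_le]
    rintro _ ⟨i, rfl⟩
    rw [Pi.basisFun_apply]
    fin_cases i
    · exact ht ▸ hW _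
    · exact hx ▸ hW _
    · exact hy ▸ hW _
  have := finrank_range_le_card (R := K) s
  rw [Set.finrank, htop, finrank_top] at this
  simp at this

theorem isEmpty_of_ne_one {q : Kˣ} (hq1 : q ≠ 1) (f : K[X]) :
    IsEmpty (QuantumHeisenberg q ≃ₐ[K] GeneralizedHeisenberg f) := by
  refine ⟨fun e => ?_⟩
  obtain ⟨χ, hχx⟩ := exists_character q
  let χ' : GeneralizedHeisenberg f →ₐ[K] K := χ.comp e.symm.toAlgHom
  obtain ⟨ψ, hψ, -, hx, hy⟩ := exists_genHom_trivSqZeroExt χ'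
    (0 : Fin 2 → K) (Pi.single 0 1) (Pi.single 1 1) (smul_zero _)
  obtain ⟨h₁, h₂, -⟩ := gaddis_relations (ψ.comp e.toAlgHom) rfl rfl rfl
  have hX : (ψ (e (RingQuot.mkAlgHom K _ (freeX K)))).fst = 1 := by simp [hψ, χ', hχx]
  have hq : (1 - (q : K)) ≠ 0 := sub_ne_zero.mpr fun h => hq1 (Units.ext h.symm)
  change ψ (e _) * ψ (e _) - (q : K) • (ψ (e _) * ψ (e _)) = ψ (e _) at h₁
  change ψ (e _) * ψ (e _) = (q : K) • (ψ (e _) * ψ (e _)) at h₂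
  have hunit : IsUnit (ψ (e (RingQuot.mkAlgHom K _ (freeX K)))) :=
    TrivSqZeroExt.isUnit_iff_isUnit_fst.mpr (by rw [hX]; exact isUnit_one)
  -- Both `1 - q` and the image of `x` are invertible. Applied to `xt = qtx`, this kills `t`; then
  -- `yx - qxy = 0` kills `y`.
  have cancel : ∀ z : TrivSqZeroExt K (Fin 2 → K),
      ψ (e (RingQuot.mkAlgHom K _ (freeX K))) * z -
        (q : K) • (ψ (e (RingQuot.mkAlgHom K _ (freeX K))) * z) = 0 → z = 0 := by
    intro z hz
    rw [← one_smul K (_ * z), smul_smul, mul_one, ← sub_smul] at hz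
    exact hunit.mul_right_eq_zero.mp ((smul_eq_zero_iff_right hq).mp hz)
  have hT : ψ (e (RingQuot.mkAlgHom K _ (freeT K))) = 0 :=
    cancel _ (by rw [sub_eq_zero]; nth_rw 2 [mul_comm]; exact h₂)
  have hY : ψ (e (RingQuot.mkAlgHom K _ (freeY K))) = 0 := by
    refine cancel _ ?_
    rw [hT, mul_comm] at h₁
    exact h₁
  have hW := snd_mem_of_algEquiv e ψ
    (Submodule.span K {(ψ (e (RingQuot.mkAlgHom K _ (freeX K)))).snd}) (by
    rintro (_ | _ | _)
    · rw [hT]; exact Submodule.zero_mem _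
    · exact Submodule.mem_span_singleton_self _
    · rw [hY]; exact Submodule.zero_mem _)
  have htop : Submodule.span K {(ψ (e (RingQuot.mkAlgHom K _ (freeX K)))).snd} = ⊤ := by
    rw [eq_top_iff, ← (Pi.basisFun K (Fin 2)).span_eq, Submodule.span_le]
    rintro _ ⟨i, rfl⟩
    rw [Pi.basisFun_apply]
    fin_cases i
    · exact hx ▸ hW _
    · exact hy ▸ hW _
  have := finrank_span_le_card (R := K) {(ψ (e (RingQuot.mkAlgHom K _ (freeX K)))).snd}
  rw [htop, finrank_top] at this
  simp at this

end HeisenbergAlgebras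

theorem mainTheorem12 {K : Type*} [Field K] (q : Kˣ) (f : K[X]) :
    IsEmpty (HeisenbergAlgebras.QuantumHeisenberg q ≃ₐ[K]
      HeisenbergAlgebras.GeneralizedHeisenberg f) := by
  rcases eq_or_ne q 1 with rfl | hq
  · exact HeisenbergAlgebras.isEmpty_of_eq_one f
  · exact HeisenbergAlgebras.isEmpty_of_ne_one hq f
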